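/- Let $p$ be a prime, $\omega=e^{2\pi i/p}$, and $n,k,n'\ge 0$. A graph on a finite vertex set $V$ is a symmetric matrix $G$ over $\mathbb F_p$ indexed by $V$ with zero diagonal (entries are edge labels, $0$ means no edge). Its graph state is $|\psi_G\rangle=p^{-|V|/2}\sum_{x\in\mathbb F_p^V}\omega^{\sum_{\{i,j\}}G_{ij}x_ix_j}|x\rangle\in(\mathbb C^p)^{\otimes V}$, and for $C\subseteq\mathbb F_p^V$ the CWS code $(G,C)$ is the span of the states $Z^{c}|\psi_G\rangle$, $c\in C$, where $Z^c|x\rangle=\omega^{c\cdot x}|x\rangle$. Inner code: a graph $G_{\rm in}$ on $n$ vertices and a linear code $C_{\rm in}\subseteq\mathbb F_p^n$ with basis $\alpha_1,\dots,\alpha_k$. Its encoder is the linear map $E:(\mathbb C^p)^{\otimes k}\to(\mathbb C^p)^{\otimes n}$, $E\varphi=\sum_{r\in\mathbb F_p^k}\langle r|(H^\dagger)^{\otimes k}|\varphi\rangle\,Z^{r_1\alpha_1+\dots+r_k\alpha_k}|\psi_{G_{\rm in}}\rangle$, where $H^\dagger|r\rangle=p^{-1/2}\sum_s\omega^{-rs}|s\rangle$.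 (This is the circuit: $H^\dagger$ on the inputs, controlled-$Z^{\alpha_{aj}}$ between input $a$ and qupit $j$ of the graph state, $H$ on the inputs, measurement of the inputs with outcome $0$.) Outer code: a CWS code $Q_{\rm out}=(G_{\rm out},C_{\rm out})$ of length $n'$ over $\mathbb C^{p^k}=(\mathbb C^p)^{\otimes k}$; here $G_{\rm out}$ is a graph on the vertices $(i,a)$, $1\le i\le n'$, $1\le a\le k$, and $C_{\rm out}\subseteq(\mathbb F_p^{k})^{n'}$ is an arbitrary subset, linear or not. The concatenated quantum code is $Q_c=E^{\otimes n'}(Q_{\rm out})$. The classical concatenated code $C_c=C_{\rm in}\odot C_{\rm out}\subseteq(\mathbb F_p^n)^{n'}$ is the set of all words $\big(\sum_a c_{i,a}\alpha_a\big)_{1\le i\le n'}$ with $c\in C_{\rm out}$. The encoding graph has auxiliary vertices $(i,a)$ carrying $G_{\rm out}$ and output vertices $(i,j)$, $1\le j\le n$, carrying $n'$ disjoint copies of $G_{\rm in}$; auxiliary vertex $(i,a)$ is joined to output vertex $(i,j)$ with label $\alpha_{a,j}$. For a graph $F$, a vertex $u$ and a vector $v$ that vanishes on $u$ and on all neighbours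 of $u$, the generalized local complementation at $(u,v)$ replaces $F$ by $F+v^Tf_u+f_u^Tv$, where $f_u$ is the row $u$ of $F$. Graph concatenation, for a given order of the auxiliary vertices, is: for each auxiliary vertex $u$ let $v_u$ be the vector of its labels to the output vertices (zero elsewhere); delete all edges between auxiliary and output vertices; perform in the given order the generalized local complementations at $(u,v_u)$ for all auxiliary $u$; remove the auxiliary vertices. It can be carried out if at each step $v_u$ vanishes on $u$ and on the current neighbours of $u$. Then: 1. The image of $E$ is the CWS code $(G_{\rm in},C_{\rm in})$. 2. If no two adjacent auxiliary vertices of the encoding graph have a common neighbour among the output vertices (automatic for $k=1$, or if $G_{\rm out}$ has no edges inside a block $\{(i,1),\dots,(i,k)\}$), then graph concatenation can be carried out in every order, with a result $G_c$ independent of the order. 3. Whenever graph concatenation can be carried out in some order, with result $G_c$, the concatenated code is the CWS code $$Q_c=(G_c,C_c),\qquad C_c=C_{\rm in}\odot C_{\rm out},$$ and every other order in which it can be carried out gives the same $G_c$. 4. In the situation of 3, let moreover $C_{\rm out}$ be linear with basis $\beta_1,\dots,\beta_m$. Then $C_c$ is linear, with basis $\gamma_l=\big(\sum_a(\beta_l)_{i,a}\alpha_a\big)_i$,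 $1\le l\le m$. If one adds to the encoding graph input vertices $1,\dots,m$, with vertex $l$ joined to the auxiliary vertices with labels $\beta_l$ and to nothing else, then graph concatenation of this larger graph in the same order can be carried out and gives the graph of the concatenated graph code, that is, $G_c$ together with the input vertices $1,\dots,m$, where $l$ is joined to the output vertices with labels $\gamma_l$ (and there are no edges between input vertices). -/

import Mathlib

open scoped BigOperators

/-! ### Graphs with edges labelled by elements of `ZMod p` -/

/-- A graph on the vertex set `V` whose edges carry non-zero labels in `ZMod p`, given by its
adjacency matrix: a symmetric matrix with zero diagonal (label `0` means `no edge`). -/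
@[ext]
structure LabeledGraph (p : ℕ) (V : Type*) where
  adj : Matrix V V (ZMod p)
  symm : ∀ i j, adj i j = adj j i
  loopless : ∀ i, adj i i = 0

namespace LabeledGraph

variable {p : ℕ} {V W U A O : Type*}

/-- The subgraph on the vertices in the image of `f`; with `f` an enumeration of the vertices that
are kept, this removes all the other vertices. -/
def induce (F : LabeledGraph p W) (f : U → W) : LabeledGraph p U where
  adj := fun i j => F.adj (f i) (f j)
  symm := fun i j => F.symm (f i) (f j)
  loopless := fun i => F.loopless (f i)

/-- Generalized local complementation at `(i, v)` may be performed on `F` if `v` vanishes on `i`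
and on all neighbours of `i`. -/
def GLCAdmissible (F : LabeledGraph p W) (i : W) (v : W → ZMod p) : Prop :=
  v i = 0 ∧ ∀ j, F.adj i j ≠ 0 → v j = 0

/-- Generalized local complementation at `(i, v)`: the adjacency matrix `F` is replaced by
`F + vᵀ fᵢ + fᵢᵀ v`, where `fᵢ` is the `i`-th row of `F`. -/
def glc (F : LabeledGraph p W) (i : W) (v : W → ZMod p) (h : F.GLCAdmissible i v) :
    LabeledGraph p W where
  adj := F.adj + Matrix.vecMulVec v (F.adj i) + Matrix.vecMulVec (F.adj i) v
  symm := by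
    intro a b
    simp only [Matrix.add_apply, Matrix.vecMulVec_apply, F.symm a b]
    ring
  loopless := by
    intro a
    have h' : v a * F.adj i a = 0 := by
      by_cases ha : F.adj i a = 0
      · rw [ha, mul_zero]
      · rw [h.2 a ha, zero_mul]
    simp only [Matrix.add_apply, Matrix.vecMulVec_apply, F.loopless a]
    rw [mul_comm (F.adj i a) (v a), h']
    simp

/-- `GLCSteps aux v l F F'`: starting from `F`, the generalized local complementations at
`(aux u, v u)`, for `u` running through the list `l` in order, can all be performed, and they lead
to `F'`. -/
def GLCSteps (aux : A → W) (v : A → W → ZMod p) :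
    List A → LabeledGraph p W → LabeledGraph p W → Prop
  | [], F, F' => F' = F
  | u :: l, F, F' => ∃ h : F.GLCAdmissible (aux u) (v u),
      GLCSteps aux v l (F.glc (aux u) (v u) h) F'

open Classical in
/-- The vector attached to the auxiliary vertex `aux u`: on an output vertex `w` it is the label of
the edge between `aux u` and `w`, and it is `0` on all other vertices. Its support is the set of
output vertices adjacent to `aux u`. -/
noncomputable def outLabels (F : LabeledGraph p W) (aux : A → W) (out : O → W) (u : A) :
    W → ZMod p :=
  fun w => if w ∈ Set.range out then F.adj (aux u) w else 0

open Classical in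
/-- Delete all edges between auxiliary vertices and output vertices. -/
noncomputable def detach (F : LabeledGraph p W) (aux : A → W) (out : O → W) :
    LabeledGraph p W where
  adj := fun i j =>
    if (i ∈ Set.range aux ∧ j ∈ Set.range out) ∨ (i ∈ Set.range out ∧ j ∈ Set.range aux) then 0
    else F.adj i j
  symm := by
    intro i j
    have h : ((i ∈ Set.range aux ∧ j ∈ Set.range out) ∨ (i ∈ Set.range out ∧ j ∈ Set.range aux))
        ↔ ((j ∈ Set.range aux ∧ i ∈ Set.range out) ∨ (j ∈ Set.range out ∧ i ∈ Set.range aux)) := by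
      tauto
    simp only [h, F.symm i j]
  loopless := by
    intro i
    simp only [F.loopless i, ite_self]

/-- `GraphConcatenation F aux out rest l R`: graph concatenation via generalized local
complementation, applied to the graph `F` with auxiliary vertices `aux`, output vertices `out` and
non-auxiliary vertices `rest`, with the auxiliary vertices processed in the order `l`, can be
carried out and yields the graph `R`. One records for every auxiliary vertex its labels to the
output vertices, deletes all edges between auxiliary and output vertices, performs the generalized
local complementations one after the other, and finally removes the auxiliary vertices. -/
def GraphConcatenation (F : LabeledGraph p W) (aux : A → W) (out : O → W) (rest : U → W)
    (l : List A) (R : LabeledGraph p U) : Prop :=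
  ∃ F' : LabeledGraph p W,
    GLCSteps aux (F.outLabels aux out) l (F.detach aux out) F' ∧ R = F'.induce rest

/-- The graph of a graph code: to the graph `G` one adds an input vertex for each row of the
generator matrix `C`; the edge between input vertex `l` and the vertex `v` of `G` has label
`C l v`, and there are no edges between input vertices. -/
def withInputs {m : ℕ} (G : LabeledGraph p V) (C : Matrix (Fin m) V (ZMod p)) :
    LabeledGraph p (Fin m ⊕ V) where
  adj := Matrix.fromBlocks 0 C C.transpose G.adj
  symm := by
    rintro (i | i) (j | j)
    · rfl
    · rfl
    · rfl
    · exact G.symm i j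
  loopless := by
    rintro (i | i)
    · rfl
    · exact G.loopless i

end LabeledGraph

/-- The encoding graph of the concatenated code, without input vertices. The auxiliary vertices
`inl (i, a)`, with `i < n'` and `a < k`, carry the outer graph. The output vertices `inr (i, j)`,
with `i < n'` and `j < n`, carry `n'` disjoint copies of the inner graph. The auxiliary vertex
`(i, a)` is joined to the vertex `(i, j)` of the `i`-th copy with label `C a j`, where `C` is the
generator matrix of the inner classical code. -/
def encodingGraph {p n k n' : ℕ} (Gin : LabeledGraph p (Fin n))
    (Cin : Matrix (Fin k) (Fin n) (ZMod p)) (Gout : LabeledGraph p (Fin n' × Fin k)) :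
    LabeledGraph p ((Fin n' × Fin k) ⊕ (Fin n' × Fin n)) where
  adj := Matrix.fromBlocks Gout.adj
    (Matrix.of fun u w => if u.1 = w.1 then Cin u.2 w.2 else 0)
    (Matrix.of fun w u => if u.1 = w.1 then Cin u.2 w.2 else 0)
    (Matrix.of fun w w' => if w.1 = w'.1 then Gin.adj w.2 w'.2 else 0)
  symm := by
    rintro (u | u) (w | w)
    · exact Gout.symm u w
    · rfl
    · rfl
    · change (if u.1 = w.1 then Gin.adj u.2 w.2 else 0) = if w.1 = u.1 then Gin.adj w.2 u.2 else 0
      rw [Gin.symm u.2 w.2]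
      exact if_congr eq_comm rfl rfl
  loopless := by
    rintro (u | u)
    · exact Gout.loopless u
    · change (if u.1 = u.1 then Gin.adj u.2 u.2 else 0) = 0
      rw [if_pos rfl, Gin.loopless u.2]

/-- The encoding graph of the concatenated code with input vertices, for a linear outer code with
generator matrix `Cout`: input vertex `l` is joined to the auxiliary vertices by the `l`-th row of
`Cout`, and it is not adjacent to any output vertex. -/
def encodingGraphWithInputs {p n k n' m : ℕ} (Gin : LabeledGraph p (Fin n))
    (Cin : Matrix (Fin k) (Fin n) (ZMod p)) (Gout : LabeledGraph p (Fin n' × Fin k))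
    (Cout : Matrix (Fin m) (Fin n' × Fin k) (ZMod p)) :
    LabeledGraph p (Fin m ⊕ ((Fin n' × Fin k) ⊕ (Fin n' × Fin n))) :=
  (encodingGraph Gin Cin Gout).withInputs (Matrix.of fun l => Sum.elim (Cout l) 0)

/-! ### Classical codes -/

/-- The rows of `C` form a basis of the linear code `D`. -/
def IsGeneratorMatrix {p m : ℕ} {V : Type*} (C : Matrix (Fin m) V (ZMod p))
    (D : Submodule (ZMod p) (V → ZMod p)) : Prop :=
  LinearIndependent (ZMod p) (fun l => C l) ∧
    Submodule.span (ZMod p) (Set.range fun l => C l) = D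

/-- Blockwise inner encoding: each of the `n'` blocks `r = (c (i, 0), …, c (i, k - 1))` is replaced
by the codeword `∑ a, r a • (row a of Cin)` which it indexes in the inner code. -/
def blockEncode {p n k n' : ℕ} (Cin : Matrix (Fin k) (Fin n) (ZMod p))
    (c : Fin n' × Fin k → ZMod p) : Fin n' × Fin n → ZMod p :=
  fun w => ∑ a, c (w.1, a) * Cin a w.2

/-- The classical concatenated code; the outer code has length `n'` over the alphabet
`(ZMod p) ^ k`, and `Cin` is the generator matrix of the inner code. -/
def classicalConcat {p n k n' : ℕ} (Cin : Matrix (Fin k) (Fin n) (ZMod p))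
    (Cout : Set (Fin n' × Fin k → ZMod p)) : Set (Fin n' × Fin n → ZMod p) :=
  blockEncode Cin '' Cout

/-! ### Qupits, graph states and CWS codes -/

/-- State vectors of the system with one qupit for each `v : V`: the function `ψ` stands for
`∑ x, ψ x • |x⟩`. -/
abbrev Ket (p : ℕ) (V : Type*) := (V → ZMod p) → ℂ

section Quantum

variable {p : ℕ} [Fact p.Prime] {V : Type*} [Fintype V]

/-- The Pauli operator `Z ^ b = ⨂ᵥ Z ^ (b v)`, with `Z |r⟩ = ω ^ r |r⟩` and
`ω = exp (2 π i / p)`. -/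
noncomputable def pauliZ (b : V → ZMod p) : Ket p V →ₗ[ℂ] Ket p V where
  toFun := fun ψ x => ZMod.stdAddChar (∑ v, b v * x v) * ψ x
  map_add' := by intro ψ φ; ext x; simp [mul_add]
  map_smul' := by intro a ψ; ext x; simp [mul_left_comm]

/-- The operator `H†` applied to every qupit, with `H† |r⟩ = p ^ (-1/2) ∑ s, ω ^ (-r s) |s⟩`. -/
noncomputable def hadamardAdjoint [DecidableEq V] : Ket p V →ₗ[ℂ] Ket p V where
  toFun := fun ψ x => ((Real.sqrt ((p : ℝ) ^ Fintype.card V) : ℝ) : ℂ)⁻¹ *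
    ∑ s : V → ZMod p, ZMod.stdAddChar (-∑ v, s v * x v) * ψ s
  map_add' := by intro ψ φ; ext x; simp [mul_add, Finset.sum_add_distrib]
  map_smul' := by intro a ψ; ext x; simp [Finset.mul_sum, mul_left_comm]

/-- The graph state: controlled-`Z` to the power `G i j` is applied, once for every unordered pair
`{i, j}` of vertices, to the uniform superposition `⨂ᵥ H† |0⟩`. -/
noncomputable def graphState [DecidableEq V] (G : LabeledGraph p V) : Ket p V :=
  fun x => ((Real.sqrt ((p : ℝ) ^ Fintype.card V) : ℝ) : ℂ)⁻¹ *
    ZMod.stdAddChar (∑ e : Sym2 V, Sym2.lift ⟨fun i j => G.adj i j * (x i * x j), fun i j => by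
      change G.adj i j * (x i * x j) = G.adj j i * (x j * x i)
      rw [G.symm i j, mul_comm (x i)]⟩ e)

/-- The CWS code `(G, C)`: the span of the states `Z ^ c |ψ_G⟩`, `c ∈ C`. -/
noncomputable def cwsCode [DecidableEq V] (G : LabeledGraph p V) (C : Set (V → ZMod p)) :
    Submodule ℂ (Ket p V) :=
  Submodule.span ℂ ((fun c => pauliZ c (graphState G)) '' C)

/-- The encoder of the graph code with graph `G` and generator matrix `C`, from `k` qupits to the
qupits of `G`. On the input `φ`: apply `H†` to each of the input qupits, apply controlled-`Z` to
the power `C a v` between input qupit `a` and qupit `v` of the graph state, which gives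
`∑ r, (H†φ) r • |r⟩ ⊗ Z ^ (r C) |ψ_G⟩`, then apply `H` to the input qupits and measure them with
outcome `0`, that is, take the inner product with `H† |0⟩ ∝ ∑ r, |r⟩` (the resulting map is
normalized to be isometric). -/
noncomputable def graphCodeEncoder [DecidableEq V] {k : ℕ} (G : LabeledGraph p V)
    (C : Matrix (Fin k) V (ZMod p)) : Ket p (Fin k) →ₗ[ℂ] Ket p V :=
  ∑ r : Fin k → ZMod p,
    ((LinearMap.proj r).comp hadamardAdjoint).smulRight
      (pauliZ (fun v => ∑ a, r a * C a v) (graphState G))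

/-- The `n'`-fold tensor power of an operator `E` from `k` to `n` qupits, acting on `n'` blocks:
its matrix entries are the products of those of `E`. -/
noncomputable def blockPower {k n : ℕ} (n' : ℕ) (E : Ket p (Fin k) →ₗ[ℂ] Ket p (Fin n)) :
    Ket p (Fin n' × Fin k) →ₗ[ℂ] Ket p (Fin n' × Fin n) where
  toFun := fun φ y => ∑ x : Fin n' × Fin k → ZMod p,
    (∏ i, E (Pi.single (fun a => x (i, a)) 1) (fun j => y (i, j))) * φ x
  map_add' := by intro ψ φ; ext x; simp [mul_add, Finset.sum_add_distrib]
  map_smul' := by intro a ψ; ext x; simp [Finset.mul_sum, mul_left_comm]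

/-- The concatenated quantum code: each of the `n'` blocks of `k` qupits of the outer code `Qout`
is encoded by the encoder of the inner graph code with graph `Gin` and generator matrix `Cin`. -/
noncomputable def concatenatedCode {n k n' : ℕ} (Gin : LabeledGraph p (Fin n))
    (Cin : Matrix (Fin k) (Fin n) (ZMod p)) (Qout : Submodule ℂ (Ket p (Fin n' × Fin k))) :
    Submodule ℂ (Ket p (Fin n' × Fin n)) :=
  Qout.map (blockPower n' (graphCodeEncoder Gin Cin))

end Quantum

/-! A labelled graph is the same thing as its quadratic form `quad`, the exponent of the graph state
(`quad_injective`). Generalized local complementation at `(u, v)` pulls this form back along the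
transvection `z ↦ z + (v ⬝ z) e_u` (`quad_glc`). The vectors used in graph concatenation vanish on
all auxiliary vertices, so the transvections commute and their displacements add up. Removing the
auxiliary vertices restricts the form to vectors `(0, y)`, which are moved to `(S y, y)` with `S =
blockSyndrome`. Hence the result has the form `Gout (S y) + ∑ i, Gin (y_i)`, in which the order no
longer occurs (`quad_of_graphConcatenation`).

On the quantum side, orthogonality of characters shows that the inner encoder sends `φ` to `y ↦
√(p^k) φ(C y) ψ_Gin(y)` (`graphCodeEncoder_apply`). Its tensor power therefore evaluates the outer
state at `S y` and multiplies by the inner graph states. For the outer state `Z^c |ψ_Gout⟩` the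
phase is `c ⬝ S y` plus exactly the form above. As `blockEncode` is the transpose of `S`, the image
is `Z^(blockEncode c) |ψ_Gc⟩`, for each codeword `c` separately; linearity of the outer code plays
no role. -/

theorem Sym2.sum_lift_eq_sum_sum {V R : Type*} [Fintype V] [DecidableEq V] [AddCommMonoid R]
    (f : V → V → R) (g : V → V → R) (hg : ∀ i j, g i j = g j i)
    (hne : ∀ i j, i ≠ j → g i j = f i j + f j i) (hdiag : ∀ i, g i i = f i i) :
    ∑ e : Sym2 V, Sym2.lift ⟨g, hg⟩ e = ∑ i, ∑ j, f i j := by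
  -- The fibre of `V × V → Sym2 V` over `s(i, j)` is `{(i, j), (j, i)}`, or a single point when `i =
  -- j`.
  have key : ∀ e : Sym2 V, Sym2.lift ⟨g, hg⟩ e
      = ∑ q : V × V with s(q.1, q.2) = e, f q.1 q.2 := by
    intro e
    induction e using Sym2.ind with
    | _ i j =>
      by_cases hij : i = j
      · subst hij
        have : (Finset.univ.filter fun q : V × V => s(q.1, q.2) = s(i, i)) = {(i, i)} := by
          ext ⟨a, b⟩; simp
        rw [this]; simp [hdiag]
      · have : (Finset.univ.filter fun q : V × V => s(q.1, q.2) = s(i, j)) = {(i, j), (j, i)} := by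
          ext ⟨a, b⟩; simp
        rw [this, Finset.sum_pair (by simp [hij])]
        simp [hne i j hij]
  rw [Finset.sum_congr rfl fun e _ => key e, Finset.sum_fiberwise, Fintype.sum_prod_type]

/-! ### The quadratic form of a labelled graph -/

namespace LabeledGraph

variable {p : ℕ} {V W W' U A O : Type*}

/-- The quadratic form `∑ G i j * x i * x j`, summed over unordered pairs of vertices, which is
the exponent in the phases of the graph state. -/
def quad [Fintype V] [DecidableEq V] (G : LabeledGraph p V) (x : V → ZMod p) : ZMod p :=
  ∑ e : Sym2 V, Sym2.lift ⟨fun i j => G.adj i j * (x i * x j), fun i j => by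
    change G.adj i j * (x i * x j) = G.adj j i * (x j * x i)
    rw [G.symm i j, mul_comm (x i)]⟩ e

section Quad

variable [Fintype V] [DecidableEq V] [Fintype W] [DecidableEq W]

theorem quad_eq_sum_sum (G : LabeledGraph p V) (x : V → ZMod p) (f : V → V → ZMod p)
    (hne : ∀ i j, i ≠ j → G.adj i j * (x i * x j) = f i j + f j i) (hdiag : ∀ i, f i i = 0) :
    G.quad x = ∑ i, ∑ j, f i j :=
  Sym2.sum_lift_eq_sum_sum f _ _ hne (by intro i; simp [G.loopless i, hdiag i])

/-- Each edge term is polarized separately. Summing over unordered pairs avoids division by two, so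
`p = 2` is included. -/
theorem quad_add (G : LabeledGraph p V) (x y : V → ZMod p) :
    G.quad (x + y) = G.quad x + G.quad y + ∑ i, ∑ j, G.adj i j * (x i * y j) := by
  have h : ∑ i, ∑ j, G.adj i j * (x i * y j) = ∑ e : Sym2 V,
      Sym2.lift ⟨fun i j => G.adj i j * (x i * y j + x j * y i), fun i j => by
        change G.adj i j * (x i * y j + x j * y i) = G.adj j i * (x j * y i + x i * y j)
        rw [G.symm i j, add_comm (x i * y j)]⟩ e :=
    (Sym2.sum_lift_eq_sum_sum _ _ _ (by intro i j _; rw [G.symm j i]; ring)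
      (by intro i; simp [G.loopless i])).symm
  rw [h, quad, quad, quad, ← Finset.sum_add_distrib, ← Finset.sum_add_distrib]
  refine Finset.sum_congr rfl fun e _ => ?_
  induction e using Sym2.ind with
  | _ i j => simp only [Sym2.lift_mk, Pi.add_apply]; ring

theorem quad_single (G : LabeledGraph p V) (i : V) (t : ZMod p) :
    G.quad (Pi.single i t) = 0 := by
  rw [G.quad_eq_sum_sum _ (fun _ _ => 0) _ (fun _ => rfl)]
  · simp
  · intro a b hab
    by_cases ha : a = i
    · subst ha; simp [Pi.single_eq_of_ne hab.symm]
    · simp [Pi.single_eq_of_ne ha]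

theorem quad_zero (G : LabeledGraph p V) : G.quad 0 = 0 := by
  simpa using G.quad_eq_sum_sum 0 (fun _ _ => 0) (by simp) (by simp)

/-- The quadratic form of a graph is the only one with its polar form that vanishes on multiples
of the standard basis vectors. -/
theorem eq_quad (G : LabeledGraph p V) (Q : (V → ZMod p) → ZMod p)
    (hs : ∀ i t, Q (Pi.single i t) = 0)
    (ha : ∀ x y, Q (x + y) = Q x + Q y + ∑ i, ∑ j, G.adj i j * (x i * y j))
    (x : V → ZMod p) : Q x = G.quad x := by
  induction x using Pi.single_induction with
  | zero => rw [quad_zero]; simpa using ha 0 0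
  | add x y hx hy => rw [ha, quad_add, hx, hy]
  | single i t => rw [hs, quad_single]

theorem sum_sum_adj_single (G : LabeledGraph p V) (a b : V) (s t : ZMod p) :
    ∑ i, ∑ j, G.adj i j * ((Pi.single a s : V → ZMod p) i * (Pi.single b t : V → ZMod p) j)
      = G.adj a b * (s * t) := by
  rw [Finset.sum_eq_single a, Finset.sum_eq_single b]
  · simp
  · intro j _ h; simp [Pi.single_eq_of_ne h]
  · simp
  · intro j _ h; simp [Pi.single_eq_of_ne h]
  · simp

/-- The polar form at two standard basis vectors reads off a matrix entry. Equality of graphs is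
always reduced to equality of forms through this lemma. -/
theorem quad_injective : Function.Injective (quad : LabeledGraph p V → _) := by
  intro G H h
  ext a b
  have hG := G.quad_add (Pi.single a 1) (Pi.single b 1)
  have hH := H.quad_add (Pi.single a 1) (Pi.single b 1)
  rw [sum_sum_adj_single, quad_single, quad_single] at hG hH
  rw [h] at hG
  simpa using hG.symm.trans hH

/-- Generalized local complementation at `(u, v)` pulls the quadratic form back along the
transvection `z ↦ z + (v ⬝ z) e_u`. -/
theorem quad_glc (F : LabeledGraph p W) (u : W) (v : W → ZMod p) (h : F.GLCAdmissible u v)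
    (z : W → ZMod p) :
    (F.glc u v h).quad z = F.quad (z + Pi.single u (v ⬝ᵥ z)) := by
  -- Admissibility makes the supports of `v` and of row `u` disjoint, so `(v ⬝ z) (f_u ⬝ z)`, the
  -- change of the form, contains no squares.
  have hvf : ∀ i, v i * F.adj u i = 0 := by
    intro i
    by_cases hi : F.adj u i = 0
    · rw [hi, mul_zero]
    · rw [h.2 i hi, zero_mul]
  rw [quad_add, quad_single, add_zero]
  have h2 : ∑ i, ∑ j, F.adj i j * (z i * (Pi.single u (v ⬝ᵥ z) : W → ZMod p) j)
      = ∑ i, ∑ j, (v i * z i) * (F.adj u j * z j) := by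
    rw [← Fintype.sum_mul_sum, Finset.mul_sum]
    refine Finset.sum_congr rfl fun i _ => ?_
    rw [Finset.sum_eq_single u]
    · rw [F.symm i u, Pi.single_eq_same, dotProduct]; ring
    · intro j _ hj; simp [Pi.single_eq_of_ne hj]
    · simp
  have h3 : ∑ i, ∑ j, (v i * z i) * (F.adj u j * z j) = ∑ e : Sym2 W,
      Sym2.lift ⟨fun i j => (v i * F.adj u j + F.adj u i * v j) * (z i * z j), fun i j => by
        ring⟩ e :=
    (Sym2.sum_lift_eq_sum_sum _ _ _ (by intro i j _; ring)
      (by intro i; linear_combination (z i * z i) * hvf i)).symm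
  rw [h2, h3, quad, quad, ← Finset.sum_add_distrib]
  refine Finset.sum_congr rfl fun e _ => ?_
  induction e using Sym2.ind with
  | _ i j =>
    simp only [Sym2.lift_mk, glc, Matrix.add_apply, Matrix.vecMulVec_apply]; ring

/-- No `v s` sees a displacement along an auxiliary vertex, so every step uses the dot product with
the original `z`, and the displacements simply add. -/
theorem quad_of_GLCSteps {aux : A → W} {v : A → W → ZMod p} (hv : ∀ u s, v u (aux s) = 0)
    {l : List A} {F F' : LabeledGraph p W} (h : GLCSteps aux v l F F') (z : W → ZMod p) :
    F'.quad z = F.quad (z + (l.map fun u => Pi.single (aux u) (v u ⬝ᵥ z)).sum) := by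
  induction l generalizing F with
  | nil => cases h; simp
  | cons u l ih =>
    obtain ⟨hu, h⟩ := h
    have h0 : v u ⬝ᵥ (l.map fun s => Pi.single (aux s) (v s ⬝ᵥ z)).sum = 0 := by
      clear ih h
      induction l with
      | nil => simp
      | cons s l ih => simp [dotProduct_add, ih, hv]
    rw [ih h, quad_glc, dotProduct_add, h0, add_zero, List.map_cons, List.sum_cons]
    congr 1; abel

end Quad

open Classical in
theorem detach_adj (F : LabeledGraph p W) (aux : A → W) (out : O → W) (i j : W) :
    (F.detach aux out).adj i j = if (i ∈ Set.range aux ∧ j ∈ Set.range out) ∨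
      (i ∈ Set.range out ∧ j ∈ Set.range aux) then 0 else F.adj i j := rfl

section WithInputs

variable {m : ℕ} (G : LabeledGraph p O) (C : Matrix (Fin m) O (ZMod p)) (l l' : Fin m) (v w : O)

theorem withInputs_adj_inl_inl : (G.withInputs C).adj (Sum.inl l) (Sum.inl l') = 0 := rfl

theorem withInputs_adj_inl_inr : (G.withInputs C).adj (Sum.inl l) (Sum.inr v) = C l v := rfl

theorem withInputs_adj_inr_inl : (G.withInputs C).adj (Sum.inr v) (Sum.inl l) = C l v := rfl

theorem withInputs_adj_inr_inr :
    (G.withInputs C).adj (Sum.inr v) (Sum.inr w) = G.adj v w := rfl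

end WithInputs

/-! ### Feasibility of sequences of local complementations -/

/-- Both hypotheses are invariants. A step at `u` adds `F u s • v u` to the row of `s`: edges
between auxiliary vertices stay fixed, and if `F u s ≠ 0` then `v u` and `v s` have disjoint
supports, so `v s` still vanishes on the neighbours of `s`. -/
theorem GLCSteps.exists_of_no_common_neighbour {aux : A → W} {v : A → W → ZMod p}
    (hv : ∀ u s, v u (aux s) = 0) (l : List A) (F : LabeledGraph p W)
    (h0 : ∀ u x, v u x ≠ 0 → F.adj (aux u) x = 0)
    (h1 : ∀ u s x, F.adj (aux u) (aux s) ≠ 0 → v u x ≠ 0 → v s x = 0) :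
    ∃ F', GLCSteps aux v l F F' := by
  induction l generalizing F with
  | nil => exact ⟨F, rfl⟩
  | cons u l ih =>
    have hu : F.GLCAdmissible (aux u) (v u) :=
      ⟨hv u u, fun j hj => by by_contra h; exact hj (h0 u j h)⟩
    have hrow : ∀ s x, (F.glc (aux u) (v u) hu).adj (aux s) x
        = F.adj (aux s) x + F.adj (aux u) (aux s) * v u x := by
      intro s x
      simp [glc, Matrix.vecMulVec_apply, hv]
    obtain ⟨F', h⟩ := ih (F.glc (aux u) (v u) hu)
      (fun s x hs => by
        rw [hrow, h0 s x hs, zero_add]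
        by_cases hus : F.adj (aux u) (aux s) = 0
        · rw [hus, zero_mul]
        · rw [h1 s u x (by rwa [F.symm]) hs, mul_zero])
      (fun s t x hst => h1 s t x (by simpa [hrow, hv] using hst))
    exact ⟨F', hu, h⟩

/-- Generalized local complementations may be performed in a larger graph when the vectors are
extended by zero. -/
theorem GLCSteps.exists_of_induce {ι : W → W'} {aux : A → W} {v : A → W → ZMod p}
    {v' : A → W' → ZMod p} (hv : ∀ u x, v' u (ι x) = v u x)
    (hv' : ∀ u x, x ∉ Set.range ι → v' u x = 0) {l : List A} {F G : LabeledGraph p W}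
    (h : GLCSteps aux v l F G) {F' : LabeledGraph p W'} (hF : F'.induce ι = F) :
    ∃ G', GLCSteps (ι ∘ aux) v' l F' G' := by
  induction l generalizing F F' with
  | nil => exact ⟨F', rfl⟩
  | cons u l ih =>
    obtain ⟨hu, h⟩ := h
    subst hF
    have hu' : F'.GLCAdmissible (ι (aux u)) (v' u) := by
      refine ⟨by rw [hv, hu.1], fun j hj => ?_⟩
      by_cases hjr : j ∈ Set.range ι
      · obtain ⟨x, rfl⟩ := hjr
        rw [hv]; exact hu.2 x hj
      · exact hv' u j hjr
    -- Local complementation commutes with passing to the induced subgraph, which keeps the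
    -- induction going.
    obtain ⟨G', hG'⟩ := ih h (F' := F'.glc _ _ hu') (by
      ext a b
      change F'.adj (ι a) (ι b) + v' u (ι a) * F'.adj (ι (aux u)) (ι b)
          + F'.adj (ι (aux u)) (ι a) * v' u (ι b)
        = F'.adj (ι a) (ι b) + v u a * F'.adj (ι (aux u)) (ι b)
          + F'.adj (ι (aux u)) (ι a) * v u b
      rw [hv, hv])
    exact ⟨G', hu', hG'⟩

end LabeledGraph

/-! ### Forms of induced subgraphs and of graphs with input vertices -/

namespace LabeledGraph

variable {p : ℕ} {A O U : Type*} [Fintype A] [Fintype O] [Fintype U]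
  [DecidableEq A] [DecidableEq O] [DecidableEq U]

/-- Extension by zero is additive and preserves multiples of basis vectors, so the restricted form
satisfies the characterization `eq_quad`. -/
theorem quad_induce_inr (F : LabeledGraph p (A ⊕ O)) (y : O → ZMod p) :
    (F.induce Sum.inr).quad y = F.quad (Sum.elim 0 y) := by
  refine (eq_quad _ (fun y => F.quad (Sum.elim 0 y)) (fun i t => ?_) (fun x y => ?_) y).symm
  · rw [Sum.elim_zero_single, quad_single]
  · have h : (Sum.elim 0 (x + y) : A ⊕ O → ZMod p)
        = Sum.elim (0 : A → ZMod p) x + Sum.elim (0 : A → ZMod p) y := by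
      ext (i | i) <;> simp
    rw [h, quad_add]
    simp [induce]

theorem quad_induce_map_id_inr (F : LabeledGraph p (U ⊕ (A ⊕ O))) (t : U → ZMod p)
    (y : O → ZMod p) :
    (F.induce (Sum.map id Sum.inr)).quad (Sum.elim t y) = F.quad (Sum.elim t (Sum.elim 0 y)) := by
  let e : (U ⊕ O → ZMod p) → (U ⊕ (A ⊕ O) → ZMod p) :=
    fun z => Sum.elim (z ∘ Sum.inl) (Sum.elim 0 (z ∘ Sum.inr))
  refine (eq_quad _ (fun z => F.quad (e z)) (fun i s => ?_) (fun x y => ?_) _).symm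
  · have h : e (Pi.single i s) = Pi.single (Sum.map id Sum.inr i) s := by
      ext (j | j | j) <;> rcases i with i | i <;> simp [e, Pi.single_apply]
    rw [h, quad_single]
  · have h : e (x + y) = e x + e y := by
      ext (j | j | j) <;> simp [e]
    rw [h, quad_add]
    simp [induce, e]

theorem quad_withInputs {m : ℕ} (G : LabeledGraph p O) (C : Matrix (Fin m) O (ZMod p))
    (t : Fin m → ZMod p) (y : O → ZMod p) :
    (G.withInputs C).quad (Sum.elim t y) = G.quad y + ∑ l, t l * ∑ v, C l v * y v := by
  refine (eq_quad _ (fun z : Fin m ⊕ O → ZMod p => G.quad (z ∘ Sum.inr)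
    + ∑ l, z (Sum.inl l) * ∑ v, C l v * z (Sum.inr v)) (fun i s => ?_) (fun x y => ?_)
    (Sum.elim t y)).symm
  · rcases i with i | i
    · have h : (Pi.single (Sum.inl i) s : Fin m ⊕ O → ZMod p) ∘ Sum.inr = 0 := by
        ext j; simp
      rw [h, quad_zero]
      simp
    · have h : (Pi.single (Sum.inr i) s : Fin m ⊕ O → ZMod p) ∘ Sum.inr = Pi.single i s := by
        ext j; simp [Pi.single_apply]
      rw [h, quad_single]
      simp
  · have h : (x + y) ∘ Sum.inr = x ∘ Sum.inr + y ∘ Sum.inr := rfl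
    rw [h, quad_add]
    have h1 : ∑ v, ∑ l, C l v * (x (Sum.inr v) * y (Sum.inl l))
        = ∑ l, y (Sum.inl l) * ∑ v, C l v * x (Sum.inr v) := by
      rw [Finset.sum_comm]
      refine Finset.sum_congr rfl fun l _ => ?_
      rw [Finset.mul_sum]
      exact Finset.sum_congr rfl fun v _ => by ring
    have h2 : ∑ l, ∑ v, C l v * (x (Sum.inl l) * y (Sum.inr v))
        = ∑ l, x (Sum.inl l) * ∑ v, C l v * y (Sum.inr v) := by
      refine Finset.sum_congr rfl fun l _ => ?_
      rw [Finset.mul_sum]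
      exact Finset.sum_congr rfl fun v _ => by ring
    simp only [withInputs, Fintype.sum_sum_type, Matrix.fromBlocks_apply₁₁,
      Matrix.fromBlocks_apply₁₂, Matrix.fromBlocks_apply₂₁, Matrix.fromBlocks_apply₂₂,
      Matrix.transpose_apply, Matrix.zero_apply, zero_mul, Finset.sum_const_zero, zero_add,
      Finset.sum_add_distrib, h1, h2, Pi.add_apply, add_mul, mul_add, Function.comp_apply]
    ring

end LabeledGraph

/-! ### Graph concatenation of the encoding graph -/

section Encoding

open LabeledGraph

variable {p n k n' m : ℕ} (Gin : LabeledGraph p (Fin n)) (Cin : Matrix (Fin k) (Fin n) (ZMod p))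
  (Gout : LabeledGraph p (Fin n' × Fin k))

/-- The blockwise transpose of `blockEncode`: it sends `y` to the vector of the products of the
rows of the inner generator matrix with the blocks of `y`. -/
def blockSyndrome (y : Fin n' × Fin n → ZMod p) : Fin n' × Fin k → ZMod p :=
  fun u => ∑ j, Cin u.2 j * y (u.1, j)

/-- This adjunction turns the phase of `Z^c` at the syndrome of `y` into that of `Z^(blockEncode c)`
at `y`; it also yields the labels at the input vertices. -/
theorem sum_mul_blockSyndrome (c : Fin n' × Fin k → ZMod p) (y : Fin n' × Fin n → ZMod p) :
    ∑ u, c u * blockSyndrome Cin y u = ∑ w, blockEncode Cin c w * y w := by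
  simp only [blockSyndrome, blockEncode, Fintype.sum_prod_type, Finset.mul_sum, Finset.sum_mul]
  refine Finset.sum_congr rfl fun i _ => ?_
  rw [Finset.sum_comm]
  exact Finset.sum_congr rfl fun j _ => Finset.sum_congr rfl fun a _ => by ring

/-- The quadratic form of the encoding graph after the edges between auxiliary and output vertices
are deleted. -/
theorem quad_detach_encodingGraph (a : Fin n' × Fin k → ZMod p) (y : Fin n' × Fin n → ZMod p) :
    ((encodingGraph Gin Cin Gout).detach Sum.inl Sum.inr).quad (Sum.elim a y)
      = Gout.quad a + ∑ i, Gin.quad fun j => y (i, j) := by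
  refine (eq_quad _ (fun z : (Fin n' × Fin k) ⊕ (Fin n' × Fin n) → ZMod p =>
    Gout.quad (z ∘ Sum.inl) + ∑ i, Gin.quad fun j => z (Sum.inr (i, j)))
    (fun i s => ?_) (fun x y => ?_) (Sum.elim a y)).symm
  · rcases i with i | ⟨i, j⟩
    · have h1 : (Pi.single (Sum.inl i) s : (Fin n' × Fin k) ⊕ (Fin n' × Fin n) → ZMod p) ∘ Sum.inl
          = Pi.single i s := by
        ext j; simp [Pi.single_apply]
      have h2 : ∀ i', (fun j => (Pi.single (Sum.inl i) s :
          (Fin n' × Fin k) ⊕ (Fin n' × Fin n) → ZMod p) (Sum.inr (i', j))) = 0 := by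
        intro i'; ext j; simp
      simp only [h1, h2, quad_single, quad_zero, Finset.sum_const_zero, add_zero]
    · have h1 : (Pi.single (Sum.inr (i, j)) s :
          (Fin n' × Fin k) ⊕ (Fin n' × Fin n) → ZMod p) ∘ Sum.inl = 0 := by
        ext j; simp
      rw [h1, quad_zero, zero_add]
      refine Finset.sum_eq_zero fun i' _ => ?_
      -- Each block of a multiple of a basis vector is again such a multiple, possibly zero.
      have h2 : (fun j' => (Pi.single (Sum.inr (i, j)) s :
          (Fin n' × Fin k) ⊕ (Fin n' × Fin n) → ZMod p) (Sum.inr (i', j')))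
            = Pi.single j (if i' = i then s else 0) := by
        ext j'
        by_cases hi : i' = i <;> simp [Pi.single_apply, hi]
      rw [h2, quad_single]
  · have h1 : (x + y) ∘ Sum.inl = x ∘ Sum.inl + y ∘ Sum.inl := rfl
    have h2 : ∀ i, (fun j => (x + y) (Sum.inr (i, j)))
        = (fun j => x (Sum.inr (i, j))) + fun j => y (Sum.inr (i, j)) := fun _ => rfl
    simp only [h1, h2, quad_add, Finset.sum_add_distrib]
    have h3 : ∑ i, ∑ j, ((encodingGraph Gin Cin Gout).detach Sum.inl Sum.inr).adj i j * (x i * y j)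
        = (∑ u, ∑ v, Gout.adj u v * (x (Sum.inl u) * y (Sum.inl v)))
          + ∑ i, ∑ j, ∑ j', Gin.adj j j' * (x (Sum.inr (i, j)) * y (Sum.inr (i, j'))) := by
      simp [detach, encodingGraph, Fintype.sum_sum_type, Fintype.sum_prod_type, ite_mul]
    rw [h3]
    simp only [Function.comp_apply]
    ring

theorem outLabels_inr (u : Fin n' × Fin k) (w : Fin n' × Fin n) :
    (encodingGraph Gin Cin Gout).outLabels Sum.inl Sum.inr u (Sum.inr w)
      = if u.1 = w.1 then Cin u.2 w.2 else 0 := by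
  simp [outLabels, encodingGraph]

theorem outLabels_inl (u v : Fin n' × Fin k) :
    (encodingGraph Gin Cin Gout).outLabels Sum.inl Sum.inr u (Sum.inl v) = 0 := by
  simp [outLabels]

theorem outLabels_dotProduct (u : Fin n' × Fin k) (a : Fin n' × Fin k → ZMod p)
    (y : Fin n' × Fin n → ZMod p) :
    (encodingGraph Gin Cin Gout).outLabels Sum.inl Sum.inr u ⬝ᵥ Sum.elim a y
      = blockSyndrome Cin y u := by
  simp [dotProduct, outLabels_inr, outLabels_inl, blockSyndrome, Fintype.sum_prod_type, ite_mul,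
    Finset.sum_ite_irrel]

/-- The processing order drops out here. -/
theorem list_sum_single_eq {W A R : Type*} [AddCommMonoid R] [Fintype A] [DecidableEq W]
    [DecidableEq A] {l : List A} (hl : l.Nodup) (hmem : ∀ u, u ∈ l) (aux : A → W) (c : A → R) :
    (l.map fun u => (Pi.single (aux u) (c u) : W → R)).sum = ∑ u, Pi.single (aux u) (c u) := by
  rw [← List.sum_toFinset _ hl]
  exact Finset.sum_congr (by ext u; simp [hmem]) fun _ _ => rfl

/-- The quadratic form of the result of graph concatenation. -/
theorem quad_of_graphConcatenation {l : List (Fin n' × Fin k)} (hl : l.Nodup)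
    (hmem : ∀ u, u ∈ l) {Gc : LabeledGraph p (Fin n' × Fin n)}
    (h : (encodingGraph Gin Cin Gout).GraphConcatenation Sum.inl Sum.inr Sum.inr l Gc)
    (y : Fin n' × Fin n → ZMod p) :
    Gc.quad y = Gout.quad (blockSyndrome Cin y) + ∑ i, Gin.quad fun j => y (i, j) := by
  obtain ⟨F', hF', rfl⟩ := h
  rw [quad_induce_inr, quad_of_GLCSteps (outLabels_inl Gin Cin Gout) hF',
    ← quad_detach_encodingGraph Gin Cin Gout, list_sum_single_eq hl hmem]
  -- The displaced vector is `(S y, y)`.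
  congr 1
  ext (u | w)
  · simp [outLabels_dotProduct, Pi.single_apply]
  · simp

theorem detach_encodingGraphWithInputs (B : Matrix (Fin m) (Fin n' × Fin k) (ZMod p)) :
    (encodingGraphWithInputs Gin Cin Gout B).detach (fun u => Sum.inr (Sum.inl u))
        (fun w => Sum.inr (Sum.inr w))
      = ((encodingGraph Gin Cin Gout).detach Sum.inl Sum.inr).withInputs
        (Matrix.of fun l => Sum.elim (B l) 0) := by
  ext (l | u | w) (l' | u' | w') <;> simp [detach_adj,
    encodingGraphWithInputs, withInputs_adj_inl_inl, withInputs_adj_inl_inr,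
    withInputs_adj_inr_inl, withInputs_adj_inr_inr]

theorem outLabels_encodingGraphWithInputs (B : Matrix (Fin m) (Fin n' × Fin k) (ZMod p))
    (u : Fin n' × Fin k) :
    (encodingGraphWithInputs Gin Cin Gout B).outLabels (fun u => Sum.inr (Sum.inl u))
        (fun w => Sum.inr (Sum.inr w)) u
      = Sum.elim (0 : Fin m → ZMod p)
        ((encodingGraph Gin Cin Gout).outLabels Sum.inl Sum.inr u) := by
  ext (l | u' | w) <;> simp [outLabels, encodingGraphWithInputs, withInputs]

/-- The vectors vanish on the input vertices, so the steps remain admissible. The input edges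
contribute `t ⬝ B a` to the form; at `a = S y` this becomes the pairing of `t` with the encoded rows
of `B` applied to `y`. -/
theorem graphConcatenation_withInputs {l : List (Fin n' × Fin k)} (hl : l.Nodup)
    (hmem : ∀ u, u ∈ l) {Gc : LabeledGraph p (Fin n' × Fin n)}
    (h : (encodingGraph Gin Cin Gout).GraphConcatenation Sum.inl Sum.inr Sum.inr l Gc)
    (B : Matrix (Fin m) (Fin n' × Fin k) (ZMod p)) :
    (encodingGraphWithInputs Gin Cin Gout B).GraphConcatenation
      (fun u => Sum.inr (Sum.inl u)) (fun w => Sum.inr (Sum.inr w)) (Sum.map id Sum.inr) l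
      (Gc.withInputs (Matrix.of fun i => blockEncode Cin (B i))) := by
  have hq := quad_of_graphConcatenation Gin Cin Gout hl hmem h
  obtain ⟨F, hF, -⟩ := h
  obtain ⟨F', hF'⟩ := hF.exists_of_induce (ι := (Sum.inr : _ → Fin m ⊕ _))
    (v' := fun u => Sum.elim 0 ((encodingGraph Gin Cin Gout).outLabels Sum.inl Sum.inr u))
    (fun _ _ => rfl)
    (by
      rintro u (l | x) hx
      · rfl
      · exact absurd ⟨x, rfl⟩ hx)
    (F' := ((encodingGraph Gin Cin Gout).detach Sum.inl Sum.inr).withInputs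
        (Matrix.of fun l => Sum.elim (B l) 0)) rfl
  refine ⟨F', ?_, quad_injective (funext fun z => ?_)⟩
  · rw [detach_encodingGraphWithInputs, funext (outLabels_encodingGraphWithInputs Gin Cin Gout B)]
    exact hF'
  · obtain ⟨t, y, rfl⟩ : ∃ t y, z = Sum.elim t y := ⟨_, _, (Sum.elim_comp_inl_inr z).symm⟩
    have hz : (Sum.elim t (Sum.elim 0 y) : Fin m ⊕ ((Fin n' × Fin k) ⊕ (Fin n' × Fin n)) → ZMod p)
        + ∑ u, Pi.single (Sum.inr (Sum.inl u)) (blockSyndrome Cin y u)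
        = Sum.elim t (Sum.elim (blockSyndrome Cin y) y) := by
      ext (i | u | w) <;> simp [Pi.single_apply]
    have hdot : ∀ u, Sum.elim (0 : Fin m → ZMod p)
          ((encodingGraph Gin Cin Gout).outLabels Sum.inl Sum.inr u)
        ⬝ᵥ Sum.elim t (Sum.elim 0 y) = blockSyndrome Cin y u := by
      intro u
      rw [← outLabels_dotProduct Gin Cin Gout u 0 y]
      simp [dotProduct]
    rw [quad_induce_map_id_inr, quad_of_GLCSteps (by intro u s; exact outLabels_inl _ _ _ u s) hF',
      list_sum_single_eq hl hmem]
    simp only [hdot, Function.comp_apply]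
    rw [hz, quad_withInputs, quad_withInputs, quad_detach_encodingGraph, hq]
    congr 1
    refine Finset.sum_congr rfl fun i _ => ?_
    simp [Fintype.sum_sum_type, ← sum_mul_blockSyndrome]

theorem exists_graphConcatenation
    (h : ∀ (u v : Fin n' × Fin k) (w : Fin n' × Fin n),
        (encodingGraph Gin Cin Gout).adj (Sum.inl u) (Sum.inl v) ≠ 0 →
        (encodingGraph Gin Cin Gout).adj (Sum.inl u) (Sum.inr w) ≠ 0 →
        (encodingGraph Gin Cin Gout).adj (Sum.inl v) (Sum.inr w) = 0) :
    ∃ Gc : LabeledGraph p (Fin n' × Fin n),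
      ∀ l : List (Fin n' × Fin k), l.Nodup → (∀ u, u ∈ l) →
        (encodingGraph Gin Cin Gout).GraphConcatenation Sum.inl Sum.inr Sum.inr l Gc := by
  have key : ∀ l, ∃ Gc, (encodingGraph Gin Cin Gout).GraphConcatenation Sum.inl Sum.inr
      (Sum.inr : Fin n' × Fin n → _) l Gc := by
    intro l
    obtain ⟨F', hF'⟩ := GLCSteps.exists_of_no_common_neighbour
      (outLabels_inl Gin Cin Gout) l
      ((encodingGraph Gin Cin Gout).detach Sum.inl Sum.inr)
      (by
        rintro u (v | w) hv
        · exact absurd (outLabels_inl ..) hv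
        · simp [detach])
      (by
        rintro u s (v | w) hus huw
        · exact outLabels_inl ..
        · have := h u s w
          simp only [outLabels, Set.mem_range_self, if_true] at huw ⊢
          exact this (by simpa [detach] using hus) huw)
    exact ⟨_, F', hF', rfl⟩
  -- One arbitrary enumeration fixes the graph; other orders agree because the form of the result
  -- does not depend on the order.
  obtain ⟨Gc, hGc⟩ := key Finset.univ.toList
  refine ⟨Gc, fun l hl hmem => ?_⟩
  obtain ⟨Gc', hGc'⟩ := key l
  have : Gc' = Gc := quad_injective (funext fun y => by
    rw [quad_of_graphConcatenation _ _ _ hl hmem hGc',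
      quad_of_graphConcatenation _ _ _ (Finset.nodup_toList _) (by simp) hGc])
  exact this ▸ hGc'

/-! ### The classical concatenated code -/

theorem blockEncode_injective (hC : LinearIndependent (ZMod p) fun a => Cin a) :
    Function.Injective (blockEncode (n' := n') Cin) := by
  intro c d h
  ext ⟨i, a⟩
  refine congrFun (hC.fintypeLinearCombination_injective
    (a₁ := fun a => c (i, a)) (a₂ := fun a => d (i, a)) ?_) a
  ext j
  simpa [Fintype.linearCombination_apply, blockEncode] using congrFun h (i, j)

/-- `blockEncode` as a linear map. -/
def blockEncodeLinear : (Fin n' × Fin k → ZMod p) →ₗ[ZMod p] (Fin n' × Fin n → ZMod p) where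
  toFun := blockEncode Cin
  map_add' := by intro c d; ext w; simp [blockEncode, add_mul, Finset.sum_add_distrib]
  map_smul' := by intro s c; ext w; simp [blockEncode, mul_assoc, Finset.mul_sum]

theorem exists_isGeneratorMatrix_classicalConcat (hC : LinearIndependent (ZMod p) fun a => Cin a)
    {B : Matrix (Fin m) (Fin n' × Fin k) (ZMod p)}
    {Dout : Submodule (ZMod p) (Fin n' × Fin k → ZMod p)} (hB : IsGeneratorMatrix B Dout) :
    ∃ Dc : Submodule (ZMod p) (Fin n' × Fin n → ZMod p),
      (Dc : Set (Fin n' × Fin n → ZMod p)) = classicalConcat Cin Dout ∧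
      IsGeneratorMatrix (Matrix.of fun i => blockEncode Cin (B i)) Dc := by
  refine ⟨Dout.map (blockEncodeLinear Cin), Submodule.map_coe _ _, ?_, ?_⟩
  · exact hB.1.map' (blockEncodeLinear Cin)
      (LinearMap.ker_eq_bot.mpr (blockEncode_injective Cin hC))
  · rw [← hB.2, Submodule.map_span, ← Set.range_comp]
    rfl

end Encoding

/-! ### Encoders, graph states and CWS codes -/

section Quantum

open LabeledGraph

theorem sqrt_pow_mul_self (p d : ℕ) :
    ((Real.sqrt ((p : ℝ) ^ d) : ℝ) : ℂ) * ((Real.sqrt ((p : ℝ) ^ d) : ℝ) : ℂ) = (p : ℂ) ^ d := by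
  rw [← Complex.ofReal_mul, Real.mul_self_sqrt (by positivity)]
  push_cast; rfl

theorem sqrt_pow_pow (p d e : ℕ) :
    ((Real.sqrt ((p : ℝ) ^ d) : ℝ) : ℂ) ^ e = ((Real.sqrt ((p : ℝ) ^ (e * d)) : ℝ) : ℂ) := by
  rw [← Complex.ofReal_pow]
  congr 1
  rw [mul_comm e d, pow_mul, Real.sqrt_eq_rpow, Real.sqrt_eq_rpow, ← Real.rpow_natCast,
    ← Real.rpow_mul (by positivity), ← Real.rpow_natCast (_ ^ d) e, ← Real.rpow_mul (by positivity),
    mul_comm]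

variable {p : ℕ} [Fact p.Prime] {V : Type*} [Fintype V] [DecidableEq V]

theorem stdAddChar_sum {ι : Type*} (s : Finset ι) (f : ι → ZMod p) :
    (ZMod.stdAddChar (∑ i ∈ s, f i) : ℂ) = ∏ i ∈ s, ZMod.stdAddChar (f i) :=
  map_prod ZMod.stdAddChar.toMonoidHom (fun i => Multiplicative.ofAdd (f i)) s

theorem sum_stdAddChar_dotProduct (t : V → ZMod p) :
    ∑ r : V → ZMod p, (ZMod.stdAddChar (∑ a, r a * t a) : ℂ)
      = if t = 0 then (p : ℂ) ^ Fintype.card V else 0 := by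
  have h : ∀ r : V → ZMod p, (ZMod.stdAddChar (∑ a, r a * t a) : ℂ)
      = ∏ a, ZMod.stdAddChar (r a * t a) := fun r => stdAddChar_sum _ _
  simp only [h]
  -- The sum over vectors factors into one complete character sum per coordinate.
  rw [← Fintype.piFinset_univ,
    ← Finset.prod_univ_sum (fun _ => Finset.univ)
      (fun a (r : ZMod p) => (ZMod.stdAddChar (r * t a) : ℂ))]
  simp only [AddChar.sum_mulShift _ (ZMod.isPrimitive_stdAddChar p), ZMod.card]
  split_ifs with ht
  · simp [ht]
  · obtain ⟨a, ha⟩ := Function.ne_iff.mp ht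
    exact Finset.prod_eq_zero (Finset.mem_univ a) (by
      rw [if_neg (by simpa using ha), Nat.cast_zero])

theorem graphState_apply (G : LabeledGraph p V) (x : V → ZMod p) :
    graphState G x = ((Real.sqrt ((p : ℝ) ^ Fintype.card V) : ℝ) : ℂ)⁻¹ *
      ZMod.stdAddChar (G.quad x) := rfl

theorem sqrt_pow_ne_zero (d : ℕ) : ((Real.sqrt ((p : ℝ) ^ d) : ℝ) : ℂ) ≠ 0 := by
  have : (0 : ℝ) < p := by exact_mod_cast (Fact.out : p.Prime).pos
  exact_mod_cast (Real.sqrt_pos.mpr (pow_pos this d)).ne'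

/-- The encoder of a graph code evaluates its input at the products of `y` with the rows of the
generator matrix. -/
theorem graphCodeEncoder_apply {k : ℕ} (G : LabeledGraph p V) (C : Matrix (Fin k) V (ZMod p))
    (φ : Ket p (Fin k)) (y : V → ZMod p) :
    graphCodeEncoder G C φ y = ((Real.sqrt ((p : ℝ) ^ k) : ℝ) : ℂ) *
      φ (fun a => ∑ v, C a v * y v) * graphState G y := by
  have hlin : ∀ r : Fin k → ZMod p, ∑ v, (∑ a, r a * C a v) * y v
      = ∑ a, r a * ∑ v, C a v * y v := by
    intro r
    simp only [Finset.sum_mul, Finset.mul_sum]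
    rw [Finset.sum_comm]
    simp only [mul_assoc]
  have h1 : graphCodeEncoder G C φ y = ∑ r : Fin k → ZMod p, ∑ s : Fin k → ZMod p,
      ((Real.sqrt ((p : ℝ) ^ k) : ℝ) : ℂ)⁻¹ * (φ s * graphState G y) *
        ZMod.stdAddChar (∑ a, r a * ((∑ v, C a v * y v) - s a)) := by
    simp only [graphCodeEncoder, LinearMap.sum_apply, Finset.sum_apply, LinearMap.smulRight_apply,
      LinearMap.comp_apply, LinearMap.proj_apply, hadamardAdjoint, pauliZ, LinearMap.coe_mk,
      AddHom.coe_mk, Pi.smul_apply, smul_eq_mul, Fintype.card_fin]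
    refine Finset.sum_congr rfl fun r _ => ?_
    rw [Finset.mul_sum, Finset.sum_mul]
    refine Finset.sum_congr rfl fun s _ => ?_
    have hexp : ∑ a, r a * ((∑ v, C a v * y v) - s a)
        = -∑ v, s v * r v + ∑ v, (∑ a, r a * C a v) * y v := by
      rw [hlin, neg_add_eq_sub, ← Finset.sum_sub_distrib]
      exact Finset.sum_congr rfl fun a _ => by ring
    rw [hexp, AddChar.map_add_eq_mul]
    ring
  -- With the sum over `r` innermost, orthogonality leaves only `s = C y`; its weight `p^k` against
  -- the normalization `1/√(p^k)` gives the factor `√(p^k)`.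
  rw [h1, Finset.sum_comm]
  simp only [← Finset.mul_sum]
  rw [Finset.sum_eq_single fun a => ∑ v, C a v * y v]
  · rw [sum_stdAddChar_dotProduct (fun a => (∑ v, C a v * y v) - ∑ v, C a v * y v),
      if_pos (by ext; simp), Fintype.card_fin, ← sqrt_pow_mul_self p k]
    field_simp [sqrt_pow_ne_zero (p := p) k]
  · intro s _ hs
    rw [sum_stdAddChar_dotProduct (fun a => (∑ v, C a v * y v) - s a), if_neg, mul_zero]
    intro h
    exact hs (funext fun a => (sub_eq_zero.mp (congrFun h a)).symm)
  · simp

theorem range_graphCodeEncoder {k : ℕ} (G : LabeledGraph p V) (C : Matrix (Fin k) V (ZMod p))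
    (D : Submodule (ZMod p) (V → ZMod p))
    (hC : Submodule.span (ZMod p) (Set.range fun a => C a) = D) :
    LinearMap.range (graphCodeEncoder G C) = cwsCode G (D : Set (V → ZMod p)) := by
  apply le_antisymm
  · rintro _ ⟨φ, rfl⟩
    rw [graphCodeEncoder, LinearMap.sum_apply]
    refine Submodule.sum_mem _ fun r _ =>
      Submodule.smul_mem _ _ (Submodule.subset_span ⟨_, ?_, rfl⟩)
    rw [← hC, SetLike.mem_coe, Submodule.mem_span_range_iff_exists_fun]
    exact ⟨r, by ext v; simp⟩
  · refine Submodule.span_le.mpr ?_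
    rintro _ ⟨c, hc, rfl⟩
    rw [← hC, SetLike.mem_coe, Submodule.mem_span_range_iff_exists_fun] at hc
    obtain ⟨r, rfl⟩ := hc
    -- The preimage is `H |r⟩`, which `H†` returns to the basis state `|r⟩` that selects `Z^(r C)
    -- |ψ_G⟩`.
    refine ⟨fun x => ((Real.sqrt ((p : ℝ) ^ k) : ℝ) : ℂ)⁻¹ * ZMod.stdAddChar (∑ a, r a * x a),
      funext fun y => ?_⟩
    have hlin : ∑ v, (∑ a, r a • C a) v * y v = ∑ a, r a * ∑ v, C a v * y v := by
      simp only [Finset.sum_apply, Pi.smul_apply, smul_eq_mul, Finset.sum_mul, Finset.mul_sum]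
      rw [Finset.sum_comm]
      simp only [mul_assoc]
    rw [graphCodeEncoder_apply, mul_inv_cancel_left₀ (sqrt_pow_ne_zero k)]
    simp only [pauliZ, LinearMap.coe_mk, AddHom.coe_mk, hlin]

variable {n k n' : ℕ} (Gin : LabeledGraph p (Fin n)) (Cin : Matrix (Fin k) (Fin n) (ZMod p))

theorem blockPower_graphCodeEncoder_apply (φ : Ket p (Fin n' × Fin k))
    (y : Fin n' × Fin n → ZMod p) :
    blockPower n' (graphCodeEncoder Gin Cin) φ y
      = ((Real.sqrt ((p : ℝ) ^ k) : ℝ) : ℂ) ^ n' * φ (blockSyndrome Cin y) *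
        ∏ i, graphState Gin fun j => y (i, j) := by
  simp only [blockPower, LinearMap.coe_mk, AddHom.coe_mk, graphCodeEncoder_apply]
  -- A basis ket `|x⟩` reaches the output `y` only if every block of `x` is the syndrome of that
  -- block of `y`.
  rw [Finset.sum_eq_single (blockSyndrome Cin y)]
  · have h : ∀ i, (Pi.single (fun a => blockSyndrome Cin y (i, a)) 1 : Ket p (Fin k))
        (fun a => ∑ j, Cin a j * y (i, j)) = 1 := fun i => Pi.single_eq_same _ _
    simp only [h, mul_one, Finset.prod_mul_distrib, Finset.prod_const, Finset.card_univ,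
      Fintype.card_fin]
    ring
  · intro x _ hx
    obtain ⟨⟨i, a⟩, hia⟩ := Function.ne_iff.mp hx
    have h : (Pi.single (fun a => x (i, a)) 1 : Ket p (Fin k))
        (fun a => ∑ j, Cin a j * y (i, j)) = 0 :=
      Pi.single_eq_of_ne (fun h => hia (congrFun h a).symm) _
    rw [Finset.prod_eq_zero (Finset.mem_univ i) (by rw [h]; simp), zero_mul]
  · simp

/-- The concatenated encoder maps the states spanning the outer code to those spanning the
concatenated code. -/
theorem blockPower_pauliZ_graphState (Gout : LabeledGraph p (Fin n' × Fin k))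
    (Gc : LabeledGraph p (Fin n' × Fin n))
    (h : ∀ y, Gc.quad y = Gout.quad (blockSyndrome Cin y) + ∑ i, Gin.quad fun j => y (i, j))
    (c : Fin n' × Fin k → ZMod p) :
    blockPower n' (graphCodeEncoder Gin Cin) (pauliZ c (graphState Gout))
      = pauliZ (blockEncode Cin c) (graphState Gc) := by
  ext y
  rw [blockPower_graphCodeEncoder_apply]
  simp only [pauliZ, LinearMap.coe_mk, AddHom.coe_mk, graphState_apply, h,
    AddChar.map_add_eq_mul, Finset.prod_mul_distrib, Finset.prod_const,
    Finset.card_univ, Fintype.card_fin, Fintype.card_prod, inv_pow, sqrt_pow_pow]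
  rw [← stdAddChar_sum, sum_mul_blockSyndrome]
  -- The encoder factor `√(p^(n'k))` cancels the normalization of the outer graph state; those of
  -- the `n'` inner states multiply to that of `Gc`.
  have := sqrt_pow_ne_zero (p := p) (n' * k)
  field_simp

theorem concatenatedCode_cwsCode (Gout : LabeledGraph p (Fin n' × Fin k))
    (Cout : Set (Fin n' × Fin k → ZMod p)) (Gc : LabeledGraph p (Fin n' × Fin n))
    (h : ∀ y, Gc.quad y = Gout.quad (blockSyndrome Cin y) + ∑ i, Gin.quad fun j => y (i, j)) :
    concatenatedCode Gin Cin (cwsCode Gout Cout) = cwsCode Gc (classicalConcat Cin Cout) := by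
  rw [concatenatedCode, cwsCode, cwsCode, classicalConcat, Submodule.map_span, Set.image_image,
    Set.image_image]
  simp only [blockPower_pauliZ_graphState Gin Cin Gout Gc h]

end Quantum

/-! ### The main theorem -/

theorem mainTheorem1 (p : ℕ) [Fact p.Prime] (n k n' : ℕ)
    -- the inner graph code, with `k`-dimensional linear code `Din` and generator matrix `Cin`
    (Gin : LabeledGraph p (Fin n)) (Din : Submodule (ZMod p) (Fin n → ZMod p))
    (Cin : Matrix (Fin k) (Fin n) (ZMod p)) (hCin : IsGeneratorMatrix Cin Din)
    -- the outer CWS code, of length `n'` over systems of `k` qupits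
    (Gout : LabeledGraph p (Fin n' × Fin k)) (Cout : Set (Fin n' × Fin k → ZMod p)) :
    -- the encoder of the inner code maps onto the CWS code `(Gin, Din)`
    LinearMap.range (graphCodeEncoder Gin Cin) = cwsCode Gin (Din : Set (Fin n → ZMod p)) ∧
    -- if no two adjacent auxiliary vertices have a common neighbour among the output vertices,
    -- then graph concatenation can be carried out in every order, always with the same result
    ((∀ (u v : Fin n' × Fin k) (w : Fin n' × Fin n),
        (encodingGraph Gin Cin Gout).adj (Sum.inl u) (Sum.inl v) ≠ 0 →
        (encodingGraph Gin Cin Gout).adj (Sum.inl u) (Sum.inr w) ≠ 0 →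
        (encodingGraph Gin Cin Gout).adj (Sum.inl v) (Sum.inr w) = 0) →
      ∃ Gc : LabeledGraph p (Fin n' × Fin n),
        ∀ l : List (Fin n' × Fin k), l.Nodup → (∀ u, u ∈ l) →
          (encodingGraph Gin Cin Gout).GraphConcatenation Sum.inl Sum.inr Sum.inr l Gc) ∧
    -- whenever graph concatenation can be carried out, in some order `l`, with result `Gc`:
    (∀ l : List (Fin n' × Fin k), l.Nodup → (∀ u, u ∈ l) →
      ∀ Gc : LabeledGraph p (Fin n' × Fin n),
        (encodingGraph Gin Cin Gout).GraphConcatenation Sum.inl Sum.inr Sum.inr l Gc →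
        -- the concatenated code is the CWS code of `Gc` and the classical concatenated code
        concatenatedCode Gin Cin (cwsCode Gout Cout) = cwsCode Gc (classicalConcat Cin Cout) ∧
        -- any other order in which it can be carried out gives the same graph
        (∀ l' : List (Fin n' × Fin k), l'.Nodup → (∀ u, u ∈ l') →
          ∀ Gc' : LabeledGraph p (Fin n' × Fin n),
            (encodingGraph Gin Cin Gout).GraphConcatenation Sum.inl Sum.inr Sum.inr l' Gc' →
            Gc' = Gc) ∧
        -- if the outer classical code is linear, with generator matrix `B`, then so is the
        -- classical concatenated code, and the same procedure on the encoding graph with input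
        -- vertices gives the graph, with input vertices, of the concatenated graph code
        (∀ (m : ℕ) (Dout : Submodule (ZMod p) (Fin n' × Fin k → ZMod p))
          (B : Matrix (Fin m) (Fin n' × Fin k) (ZMod p)),
          (Dout : Set (Fin n' × Fin k → ZMod p)) = Cout → IsGeneratorMatrix B Dout →
          (∃ Dc : Submodule (ZMod p) (Fin n' × Fin n → ZMod p),
            (Dc : Set (Fin n' × Fin n → ZMod p)) = classicalConcat Cin Cout ∧
            IsGeneratorMatrix (Matrix.of fun i => blockEncode Cin (B i)) Dc) ∧
          (encodingGraphWithInputs Gin Cin Gout B).GraphConcatenation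
            (fun u => Sum.inr (Sum.inl u)) (fun w => Sum.inr (Sum.inr w))
            (Sum.map id Sum.inr) l
            (Gc.withInputs (Matrix.of fun i => blockEncode Cin (B i))))) := by
  refine ⟨range_graphCodeEncoder Gin Cin Din hCin.2, exists_graphConcatenation Gin Cin Gout, ?_⟩
  intro l hl hmem Gc hGc
  have hq := quad_of_graphConcatenation Gin Cin Gout hl hmem hGc
  refine ⟨concatenatedCode_cwsCode Gin Cin Gout Cout Gc hq, ?_, ?_⟩
  · intro l' hl' hmem' Gc' hGc'
    exact LabeledGraph.quad_injective (funext fun y => by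
      rw [hq, quad_of_graphConcatenation Gin Cin Gout hl' hmem' hGc'])
  · rintro m Dout B rfl hB
    exact ⟨exists_isGeneratorMatrix_classicalConcat Cin hCin.1 hB,
      graphConcatenation_withInputs Gin Cin Gout hl hmem hGc B⟩
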